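/- All graphs are finite and simple. For a graph $G$, let $|G|$ be its number of vertices and $\Delta(G)$ its maximum degree. An orientation of $G$ is a digraph $D$ obtained by giving each edge of $G$ exactly one of its two directions. Let $A(D)$ be the set of arcs of $D$ and $m=|A(D)|$. For a bijection $\tau:A(D)\to\{1,\dots,m\}$, the vertex-sum of a vertex $v$ is the sum of the labels of all arcs entering $v$ minus the sum of the labels of all arcs leaving $v$ (so it is $0$ if $v$ is isolated). The graph $G$ has an antimagic orientation if there are an orientation $D$ of $G$ and such a bijection $\tau$ for which distinct vertices have distinct vertex-sums. Theorem. Let $G$ be a connected graph. (i) If $\Delta(G)\ge |G|-3$, then $G$ has an antimagic orientation. (ii) For each $t\in\{4,5\}$: if $\Delta(G)=|G|-t\ge 4$, then $G$ has an antimagic orientation. -/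

import Mathlib

namespace Digraph

/-- `D` is an orientation of the simple graph `G`: every arc of `D` lies along an edge of `G`, and
every edge of `G` is present in `D` in exactly one of its two directions. -/
structure IsOrientationOf {V : Type*} (D : Digraph V) (G : SimpleGraph V) : Prop where
  adj_of_arc : ∀ u v, D.Adj u v → G.Adj u v
  oneDirection : ∀ u v, G.Adj u v → Xor (D.Adj u v) (D.Adj v u)

/-- The arc set `A(D)`; the pair `(u, v)` is the arc leaving `u` and entering `v`. -/
def arcSet {V : Type*} (D : Digraph V) : Set (V × V) := {a | D.Adj a.1 a.2}

open Classical in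
/-- The vertex-sum of `v`: the sum of the labels of all arcs entering `v` minus the sum of the
labels of all arcs leaving `v` (so it is `0` at an isolated vertex).
Only the values of `τ` on `A(D)` matter. -/
noncomputable def vertexSum {V : Type*} [Fintype V] (D : Digraph V) (τ : V × V → ℕ) (v : V) : ℤ :=
  (∑ u with D.Adj u v, (τ (u, v) : ℤ)) - ∑ w with D.Adj v w, (τ (v, w) : ℤ)

/-- `τ` restricts to a bijection from `A(D)` to `{1, …, m}`, where `m = |A(D)|`, and no two
distinct vertices have the same vertex-sum. -/
structure IsAntimagicLabeling {V : Type*} [Fintype V] (D : Digraph V) (τ : V × V → ℕ) : Prop where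
  bijOn : Set.BijOn τ D.arcSet (Set.Icc 1 D.arcSet.ncard)
  vertexSum_ne : ∀ u v, u ≠ v → D.vertexSum τ u ≠ D.vertexSum τ v

end Digraph

/-- `G` has an antimagic orientation: some orientation of `G` has an antimagic labeling. -/
def SimpleGraph.HasAntimagicOrientation {V : Type*} [Fintype V] (G : SimpleGraph V) : Prop :=
  ∃ (D : Digraph V) (τ : V × V → ℕ), D.IsOrientationOf G ∧ D.IsAntimagicLabeling τ

/-!
The condition that is used is only that a vertex `x` of maximum degree `d` has at most four
non-neighbours. Let `A` be the set of neighbours of `x` and `B` the set of the other vertices, let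
`W ⊆ B` be the set of vertices with a neighbour in `A`, and write `Z = B \ W`.

The `d` largest labels `M + 1, …, M + d` go to the star at `x`, whose edges are directed away from
`x`. They are handed out in the order of the partial sums of the vertices of `A`, which makes the
sums in `A` distinct. The sum of `x` is at most `-d (M + 1)`, while a vertex of `B` has at most `d`
edges with labels at most `M`; so `x` has the smallest sum. It remains to label everything else so
that, for some `δ`, the sums in `B` are distinct and at most `δ`, and the partial sums in `A` are at
least `δ - M` (`exists_labeling_off_star`).

* Inside `A`, labels are handed out in increasing order along trails traversed backwards. Every
  vertex then loses at most one label that a larger incoming label does not compensate, so that all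
  partial sums are at least minus the largest label used
  (`exists_isSignedLabeling_neg_le_vsum`).
* The edges between `W` and `A` are directed towards `A` and carry labels above those inside `A`
  and `B`. One such edge per vertex of `W` is reserved, and the reserved edges receive their labels
  in sorted order, which makes the sums in `W` distinct. These sums are also very small.
* The edges inside `B` carry the smallest labels, in such a way that the sums in `Z` are distinct,
  at most `|W|`, and not too negative, so that they avoid the sums in `A` and in `W`. When `Z` is
  empty, a trail labeling does this. If `Z` is not empty, then `|W| ≤ 3`. In general `B` is a graph
  on at most four vertices; up to isolated vertices it is a graph on `Fin 4` in which `W` comes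
  first. For these graphs, a few fixed orders of the six pairs, with signs for the directions,
  suffice (`separated_two`, `separated_three`, `rootSeparated_small`, `rootSeparated_large`), when
  the edges that are present are labelled in that order (`isSignedLabeling_compress`). If `W` is a
  single vertex, the order depends on the total label `R` between that vertex and `A`, and for some
  small `R` the labels inside `B` have to be placed above those inside `A`.

Labelled orientations are encoded as antisymmetric integer matrices (`IsSignedLabeling`), so that
edge-disjoint parts combine by addition and vertex-sums are column sums.
-/

open Finset

/-! ### Signed labelings -/

/-- A labelled orientation of `H`, encoded as an antisymmetric integer matrix: `f u v = i > 0` means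
that the edge `uv` is directed from `u` to `v` and carries the label `i`. The labels in use are
exactly `L + 1, …, L + m`, each of them once. -/
structure IsSignedLabeling {V : Type*} (H : SimpleGraph V) (f : V → V → ℤ) (L m : ℕ) : Prop where
  anti : ∀ u v, f v u = -f u v
  zero : ∀ u v, ¬H.Adj u v → f u v = 0
  mem : ∀ u v, H.Adj u v → (L : ℤ) < |f u v| ∧ |f u v| ≤ L + m
  inj : ∀ u v u' v', 0 < f u v → f u v = f u' v' → u = u' ∧ v = v'
  surj : ∀ i : ℕ, L < i → i ≤ L + m → ∃ u v, f u v = i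

/-- The vertex-sum of `v` in a signed labeling: incoming arcs count positively, outgoing arcs
negatively. -/
def vsum {V : Type*} [Fintype V] (f : V → V → ℤ) (v : V) : ℤ := ∑ u, f u v

section Basic

variable {V : Type*} {H H₁ H₂ : SimpleGraph V} {f f₁ f₂ : V → V → ℤ} {L m m₁ m₂ : ℕ}

theorem IsSignedLabeling.ne_zero (hf : IsSignedLabeling H f L m) {u v : V} (h : H.Adj u v) :
    f u v ≠ 0 := by
  intro h0
  have := (hf.mem u v h).1
  rw [h0, abs_zero] at this
  omega

theorem IsSignedLabeling.adj (hf : IsSignedLabeling H f L m) {u v : V} (h : f u v ≠ 0) :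
    H.Adj u v := by
  by_contra hn
  exact h (hf.zero u v hn)

theorem IsSignedLabeling.neg (hf : IsSignedLabeling H f L m) :
    IsSignedLabeling H (fun u v => -f u v) L m where
  anti u v := by rw [hf.anti u v]
  zero u v h := by simp [hf.zero u v h]
  mem u v h := by simpa using hf.mem u v h
  inj u v u' v' h h' := by
    rw [← hf.anti, ← hf.anti] at h'
    rw [← hf.anti] at h
    exact (hf.inj _ _ _ _ h h').symm
  surj i h h' := by
    obtain ⟨u, v, huv⟩ := hf.surj i h h'
    exact ⟨v, u, by rw [hf.anti u v, neg_neg, huv]⟩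

/-- Two signed labelings with consecutive label intervals combine to one of the edge-disjoint
union. -/
theorem IsSignedLabeling.sup (h₁ : IsSignedLabeling H₁ f₁ L m₁)
    (h₂ : IsSignedLabeling H₂ f₂ (L + m₁) m₂) (hd : ∀ u v, H₁.Adj u v → ¬H₂.Adj u v) :
    IsSignedLabeling (H₁ ⊔ H₂) (fun u v => f₁ u v + f₂ u v) L (m₁ + m₂) := by
  have key : ∀ u v, (f₂ u v = 0 ∧ |f₁ u v| ≤ L + m₁) ∨
      (f₁ u v = 0 ∧ (L + m₁ : ℤ) < |f₂ u v|) := by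
    intro u v
    by_cases h : H₁.Adj u v
    · exact Or.inl ⟨h₂.zero _ _ (hd u v h), (h₁.mem u v h).2⟩
    · by_cases h' : H₂.Adj u v
      · exact Or.inr ⟨h₁.zero _ _ h, by simpa using (h₂.mem u v h').1⟩
      · refine Or.inl ⟨h₂.zero _ _ h', ?_⟩
        rw [h₁.zero _ _ h, abs_zero]
        positivity
  refine ⟨fun u v => ?_, fun u v h => ?_, fun u v h => ?_, fun u v u' v' h h' => ?_,
    fun i h h' => ?_⟩
  · rw [h₁.anti u v, h₂.anti u v]
    ring
  · rw [SimpleGraph.sup_adj, not_or] at h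
    rw [h₁.zero _ _ h.1, h₂.zero _ _ h.2, add_zero]
  · rcases h with h | h
    · rw [h₂.zero _ _ (hd u v h), add_zero]
      have := h₁.mem u v h
      push_cast
      constructor <;> linarith
    · rw [h₁.zero _ _ fun h' => hd u v h' h, zero_add]
      have := h₂.mem u v h
      push_cast at this ⊢
      constructor <;> linarith
  · rcases key u v with ⟨e, b⟩ | ⟨e, b⟩ <;> rcases key u' v' with ⟨e', b'⟩ | ⟨e', b'⟩ <;>
      simp only [e, e', add_zero, zero_add] at h h'
    · exact h₁.inj _ _ _ _ h h'
    · rw [h'] at b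
      exact absurd b (not_le.mpr b')
    · rw [h'] at b
      exact absurd b' (not_le.mpr b)
    · exact h₂.inj _ _ _ _ h h'
  · by_cases hi : i ≤ L + m₁
    · obtain ⟨u, v, huv⟩ := h₁.surj i h hi
      refine ⟨u, v, ?_⟩
      have ha : H₁.Adj u v := h₁.adj (by rw [huv]; exact_mod_cast (by omega : i ≠ 0))
      rw [h₂.zero _ _ (hd u v ha), add_zero, huv]
    · obtain ⟨u, v, huv⟩ := h₂.surj i (by omega) (by omega)
      refine ⟨u, v, ?_⟩
      have ha : H₂.Adj u v := h₂.adj (by rw [huv]; exact_mod_cast (by omega : i ≠ 0))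
      rw [h₁.zero _ _ fun h' => hd u v h' ha, zero_add, huv]

theorem isSignedLabeling_bot (L : ℕ) : IsSignedLabeling (⊥ : SimpleGraph V) (fun _ _ => 0) L 0 where
  anti _ _ := by simp
  zero _ _ _ := rfl
  mem _ _ h := h.elim
  inj _ _ _ _ h := absurd h (lt_irrefl _)
  surj i h h' := by omega

theorem IsSignedLabeling.eq_zero_of_forall_not_adj (hf : IsSignedLabeling H f L m)
    (h : ∀ u v, ¬H.Adj u v) : m = 0 := by
  by_contra hm
  obtain ⟨u, v, huv⟩ := hf.surj (L + 1) (by omega) (by omega)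
  exact h u v (hf.adj (by rw [huv]; exact_mod_cast (by omega : L + 1 ≠ 0)))

end Basic

section Sums

variable {V : Type*} [Fintype V] {H : SimpleGraph V} {f f₁ f₂ : V → V → ℤ} {L m : ℕ}

theorem vsum_add (f₁ f₂ : V → V → ℤ) (v : V) :
    vsum (fun u v => f₁ u v + f₂ u v) v = vsum f₁ v + vsum f₂ v := by
  simp [vsum, Finset.sum_add_distrib]

theorem vsum_neg (f : V → V → ℤ) (v : V) : vsum (fun u v => -f u v) v = -vsum f v := by
  simp [vsum]

theorem IsSignedLabeling.vsum_eq_zero (hf : IsSignedLabeling H f L m) {v : V}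
    (h : ∀ u, ¬H.Adj u v) : vsum f v = 0 :=
  Finset.sum_eq_zero fun u _ => hf.zero u v (h u)

theorem IsSignedLabeling.neg_le_vsum [DecidableRel H.Adj] (hf : IsSignedLabeling H f L m) (v : V) :
    -((H.degree v : ℤ) * (L + m)) ≤ vsum f v := by
  have h : ∀ u, f u v = if H.Adj v u then f u v else 0 := by
    intro u
    split_ifs with h
    · rfl
    · exact hf.zero u v fun h' => h h'.symm
  have : vsum f v = ∑ u ∈ H.neighborFinset v, f u v := by
    rw [vsum, Finset.sum_congr rfl fun u _ => h u, ← Finset.sum_filter]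
    congr 1
    ext u
    simp
  rw [this, ← SimpleGraph.card_neighborFinset_eq_degree, ← mul_neg, ← nsmul_eq_mul]
  refine Finset.card_nsmul_le_sum _ _ _ fun u hu => ?_
  have h2 := (hf.mem u v ((SimpleGraph.mem_neighborFinset _ _ _).mp hu).symm).2
  linarith [neg_abs_le (f u v)]

/-- A signed labeling of the whole graph with labels `1, …, m` and pairwise distinct vertex-sums
is an antimagic orientation. -/
theorem IsSignedLabeling.hasAntimagicOrientation {G : SimpleGraph V}
    (hf : IsSignedLabeling G f 0 m) (hinj : Function.Injective (vsum f)) :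
    G.HasAntimagicOrientation := by
  classical
  have hbij : Set.BijOn (fun p : V × V => (f p.1 p.2).toNat)
      (Digraph.arcSet ⟨fun u v => 0 < f u v⟩) (Set.Icc 1 m) := by
    refine ⟨fun p hp => ?_, fun p hp q hq h => ?_, fun i hi => ?_⟩
    · have hp : 0 < f p.1 p.2 := hp
      have h2 := (hf.mem p.1 p.2 (hf.adj hp.ne')).2
      rw [abs_of_pos hp] at h2
      simp only [Set.mem_Icc]
      push_cast at h2
      omega
    · have hp : 0 < f p.1 p.2 := hp
      have hq : 0 < f q.1 q.2 := hq
      have h : (f p.1 p.2).toNat = (f q.1 q.2).toNat := h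
      have := hf.inj p.1 p.2 q.1 q.2 hp (by omega)
      exact Prod.ext this.1 this.2
    · obtain ⟨u, v, huv⟩ := hf.surj i (by have := hi.1; omega) (by have := hi.2; omega)
      refine ⟨(u, v), ?_, by simp [huv]⟩
      change 0 < f u v
      rw [huv]
      exact_mod_cast hi.1
  have hcard : (Digraph.arcSet (⟨fun u v => 0 < f u v⟩ : Digraph V)).ncard = m := by
    rw [← hbij.injOn.ncard_image, hbij.image_eq, ← Finset.coe_Icc,
      Set.ncard_coe_finset]
    simp
  have hsum : ∀ v, Digraph.vertexSum ⟨fun u v => 0 < f u v⟩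
      (fun p : V × V => (f p.1 p.2).toNat) v = vsum f v := by
    intro v
    rw [Digraph.vertexSum, Finset.sum_filter, Finset.sum_filter, ← Finset.sum_sub_distrib, vsum]
    refine Finset.sum_congr rfl fun u _ => ?_
    have h1 := hf.anti u v
    simp only
    split_ifs <;> omega
  refine ⟨⟨fun u v => 0 < f u v⟩, fun p => (f p.1 p.2).toNat, ⟨fun u v h => ?_, fun u v h => ?_⟩,
    ⟨by rw [hcard]; exact hbij, fun u v huv h => ?_⟩⟩
  · exact hf.adj (ne_of_gt h)
  · have h0 := hf.ne_zero h
    have h1 := hf.anti u v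
    simp only [Xor]
    omega
  · rw [hsum, hsum] at h
    exact huv (hinj h)

end Sums

/-! ### Constructions of signed labelings -/

section Arc

variable {V : Type*} [DecidableEq V]

/-- The signed labeling with the single arc from `a` to `b`, labelled `l`. -/
def arc (a b : V) (l : ℤ) (u v : V) : ℤ :=
  if u = a ∧ v = b then l else if u = b ∧ v = a then -l else 0

theorem isSignedLabeling_arc {a b : V} (hab : a ≠ b) (L : ℕ) :
    IsSignedLabeling (SimpleGraph.edge a b) (arc a b (L + 1)) L 1 := by
  have hpos : ∀ u v, 0 < arc a b (L + 1) u v → u = a ∧ v = b := by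
    intro u v h
    unfold arc at h
    split_ifs at h with h1 h2
    · exact h1
    · omega
    · omega
  refine ⟨fun u v => ?_, fun u v h => ?_, fun u v h => ?_, fun u v u' v' h h' => ?_,
    fun i h h' => ⟨a, b, ?_⟩⟩
  · unfold arc
    by_cases h1 : u = a ∧ v = b
    · obtain ⟨rfl, rfl⟩ := h1
      simp [hab]
    · by_cases h2 : u = b ∧ v = a
      · obtain ⟨rfl, rfl⟩ := h2
        simp [hab]
      · rw [if_neg (by tauto), if_neg (by tauto), if_neg h1, if_neg h2, neg_zero]
  · rw [SimpleGraph.edge_adj] at h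
    unfold arc
    rw [if_neg, if_neg]
    · rintro ⟨rfl, rfl⟩
      exact h ⟨Or.inr ⟨rfl, rfl⟩, hab.symm⟩
    · rintro ⟨rfl, rfl⟩
      exact h ⟨Or.inl ⟨rfl, rfl⟩, hab⟩
  · rw [SimpleGraph.edge_adj] at h
    have : |arc a b (L + 1) u v| = L + 1 := by
      rcases h.1 with ⟨rfl, rfl⟩ | ⟨rfl, rfl⟩
      · simp only [arc, and_self, if_true]
        exact abs_of_pos (by positivity)
      · rw [arc, if_neg (fun h => hab h.1.symm), if_pos ⟨rfl, rfl⟩, abs_neg]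
        exact abs_of_pos (by positivity)
    rw [this]
    constructor <;> push_cast <;> linarith
  · have h1 := hpos u v h
    have h2 := hpos u' v' (h' ▸ h)
    exact ⟨h1.1.trans h2.1.symm, h1.2.trans h2.2.symm⟩
  · rw [arc, if_pos ⟨rfl, rfl⟩]
    have : i = L + 1 := by omega
    rw [this]
    push_cast
    rfl

theorem vsum_arc [Fintype V] {a b : V} (hab : a ≠ b) (l : ℤ) (v : V) :
    vsum (arc a b l) v = if v = b then l else if v = a then -l else 0 := by
  unfold vsum arc
  by_cases hb : v = b
  · subst hb
    simp [hab.symm]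
  · by_cases ha : v = a
    · subst ha
      simp [hb]
    · simp [ha, hb]

/-- Prepending a single arc with the smallest label to a signed labeling of `H` minus an edge. -/
theorem IsSignedLabeling.cons_arc {H : SimpleGraph V} {f : V → V → ℤ} {L n : ℕ} {a b : V}
    (hab : H.Adj a b) (hf : IsSignedLabeling (H.deleteEdges {s(a, b)}) f (L + 1) n) :
    IsSignedLabeling H (fun u v => arc a b (L + 1) u v + f u v) L (n + 1) := by
  have hH : H = SimpleGraph.edge a b ⊔ H.deleteEdges {s(a, b)} := by
    ext u v
    simp only [SimpleGraph.sup_adj, SimpleGraph.edge_adj, SimpleGraph.deleteEdges_adj,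
      Set.mem_singleton_iff, Sym2.eq_iff]
    constructor
    · intro h
      by_cases h' : u = a ∧ v = b ∨ u = b ∧ v = a
      · exact Or.inl ⟨h', h.ne⟩
      · exact Or.inr ⟨h, h'⟩
    · rintro (⟨⟨rfl, rfl⟩ | ⟨rfl, rfl⟩, _⟩ | h)
      · exact hab
      · exact hab.symm
      · exact h.1
  have := (isSignedLabeling_arc hab.ne L).sup hf (by
    intro u v h h'
    rw [SimpleGraph.edge_adj] at h
    rw [SimpleGraph.deleteEdges_adj, Set.mem_singleton_iff, Sym2.eq_iff] at h'
    exact h'.2 h.1)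
  rwa [← hH, add_comm 1 n] at this

end Arc

/-- Handing out the labels `L + 1, …, L + |S|` in the order of given partial sums `g` keeps the
resulting sums distinct. -/
theorem exists_sorted_labels {V : Type*} [DecidableEq V] (S : Finset V) (g : V → ℤ) (L : ℕ) :
    ∃ l : V → ℕ, (∀ v ∈ S, L < l v ∧ l v ≤ L + #S) ∧ Set.InjOn l S ∧
      Set.InjOn (fun v => g v + l v) S := by
  induction S using Finset.induction_on_max_value g with
  | empty => exact ⟨fun _ => 0, by simp⟩
  | insert a s ha hmax ih =>
    obtain ⟨l, h1, h2, h3⟩ := ih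
    have hne : ∀ v ∈ s, v ≠ a := fun v hv h => ha (h ▸ hv)
    refine ⟨Function.update l a (L + #s + 1), fun v hv => ?_, ?_, ?_⟩
    · rw [card_insert_of_notMem ha]
      by_cases hva : v = a
      · subst hva
        simp only [Function.update_self]
        omega
      · have := h1 v (Finset.mem_of_mem_insert_of_ne hv hva)
        simp only [Function.update_of_ne hva]
        omega
    · rw [coe_insert, Set.injOn_insert (by simpa using ha)]
      refine ⟨fun u hu v hv h => ?_, ?_⟩
      · rw [Function.update_of_ne (hne u hu), Function.update_of_ne (hne v hv)] at h
        exact h2 hu hv h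
      · rintro ⟨v, hv, h⟩
        rw [Function.update_of_ne (hne v hv), Function.update_self] at h
        have := h1 v hv
        omega
    · rw [coe_insert, Set.injOn_insert (by simpa using ha)]
      refine ⟨fun u hu v hv h => ?_, ?_⟩
      · simp only [Function.update_of_ne (hne u hu), Function.update_of_ne (hne v hv)] at h
        exact h3 hu hv h
      · rintro ⟨v, hv, h⟩
        simp only [Function.update_of_ne (hne v hv), Function.update_self] at h
        have := h1 v hv
        have := hmax v hv
        push_cast at h
        omega

section Constructions

theorem ncard_edgeSet_deleteEdges_singleton {V : Type*} [Finite V] {H : SimpleGraph V} {n : ℕ}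
    {a b : V} (hab : H.Adj a b) (hn : H.edgeSet.ncard = n + 1) :
    (H.deleteEdges {s(a, b)}).edgeSet.ncard = n := by
  rw [SimpleGraph.edgeSet_deleteEdges, Set.ncard_sdiff_singleton_of_mem (by exact hab), hn]
  rfl

variable {V : Type*} [Fintype V]

/-- A signed labeling in which no vertex-sum is below minus the largest label. The labels are
handed out in increasing order along trails traversed backwards, so that each vertex loses at most
one label that is not compensated by a larger incoming one; `u` is the current end of the trail. -/
theorem exists_isSignedLabeling_neg_le_vsum_aux [DecidableEq V] (n : ℕ) :
    ∀ (H : SimpleGraph V), H.edgeSet.ncard = n → ∀ (L : ℕ) (u : V),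
      ∃ f, IsSignedLabeling H f L n ∧ (∀ w, -((L : ℤ) + n) ≤ vsum f w) ∧ -(n : ℤ) ≤ vsum f u := by
  induction n with
  | zero =>
    intro H hH L u
    have : H = ⊥ := by
      rw [← SimpleGraph.edgeSet_eq_empty]
      exact (Set.ncard_eq_zero).mp hH
    subst this
    refine ⟨_, isSignedLabeling_bot L, fun w => ?_, ?_⟩ <;> simp [vsum]
  | succ n ih =>
    intro H hH L u
    -- an edge at `u` is used if there is one, so that the trail ends only at an exhausted vertex
    obtain ⟨a, b, hab, hb⟩ : ∃ a b, H.Adj a b ∧ (b ≠ u → ∀ v, ¬H.Adj v u) := by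
      by_cases hu : ∃ v, H.Adj v u
      · obtain ⟨v, hv⟩ := hu
        exact ⟨v, u, hv, fun h => absurd rfl h⟩
      · push Not at hu
        obtain ⟨e, he⟩ : H.edgeSet.Nonempty := by
          rw [← Set.ncard_pos]
          omega
        induction e with
        | _ a b => exact ⟨a, b, he, fun _ => hu⟩
    obtain ⟨f, hf, h1, h2⟩ :=
      ih _ (ncard_edgeSet_deleteEdges_singleton hab hH) (L + 1) a
    have hf' := hf.cons_arc hab
    have hs : ∀ w, vsum (fun u v => arc a b (L + 1) u v + f u v) w =
        (if w = b then (L + 1 : ℤ) else if w = a then -(L + 1 : ℤ) else 0) + vsum f w := by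
      intro w
      rw [vsum_add, vsum_arc hab.ne]
    refine ⟨_, hf', fun w => ?_, ?_⟩
    · have h1w := h1 w
      rw [hs w]
      push_cast at h1w ⊢
      by_cases hwb : w = b
      · rw [if_pos hwb]
        omega
      · rw [if_neg hwb]
        by_cases hwa : w = a
        · subst hwa
          rw [if_pos rfl]
          omega
        · rw [if_neg hwa]
          omega
    · by_cases hbu : b = u
      · subst hbu
        have h1u := h1 b
        rw [hs, if_pos rfl]
        push_cast at h1u ⊢
        omega
      · rw [hf'.vsum_eq_zero (hb hbu)]
        push_cast
        omega

theorem exists_isSignedLabeling_neg_le_vsum (H : SimpleGraph V) :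
    ∃ m, ∀ L, ∃ f, IsSignedLabeling H f L m ∧ ∀ w, -((L : ℤ) + m) ≤ vsum f w := by
  classical
  refine ⟨H.edgeSet.ncard, fun L => ?_⟩
  cases isEmpty_or_nonempty V with
  | inl h =>
    have : H = ⊥ := Subsingleton.elim _ _
    subst this
    refine ⟨_, by simpa using isSignedLabeling_bot L, fun w => h.elim w⟩
  | inr h =>
    obtain ⟨f, hf, h1, -⟩ :=
      exists_isSignedLabeling_neg_le_vsum_aux _ H rfl L h.some
    exact ⟨f, hf, h1⟩

/-- The edges of a bipartite graph can be directed from the side `P` to the other side. -/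
theorem exists_isSignedLabeling_bipartite (H : SimpleGraph V) (P : V → Prop)
    (hP : ∀ u v, H.Adj u v → (P u ↔ ¬P v)) (L : ℕ) :
    ∃ f m, IsSignedLabeling H f L m ∧ (∀ v, P v → vsum f v ≤ 0) ∧ (∀ v, ¬P v → 0 ≤ vsum f v) ∧
      ∀ u v, P v → H.Adj u v → vsum f v ≤ -(L + 1) := by
  classical
  have main : ∀ n (H : SimpleGraph V), H.edgeSet.ncard = n →
      (∀ u v, H.Adj u v → (P u ↔ ¬P v)) → ∀ L,
      ∃ f, IsSignedLabeling H f L n ∧ ∀ u v, 0 < f u v → P u := by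
    intro n
    induction n with
    | zero =>
      intro H hH _ L
      have : H = ⊥ := by
        rw [← SimpleGraph.edgeSet_eq_empty]
        exact (Set.ncard_eq_zero).mp hH
      subst this
      exact ⟨_, isSignedLabeling_bot L, fun u v h => absurd h (lt_irrefl _)⟩
    | succ n ih =>
      intro H hH hP L
      obtain ⟨a, b, hab, ha⟩ : ∃ a b, H.Adj a b ∧ P a := by
        obtain ⟨e, he⟩ : H.edgeSet.Nonempty := by
          rw [← Set.ncard_pos]
          omega
        induction e with
        | _ a b =>
          by_cases ha : P a
          · exact ⟨a, b, he, ha⟩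
          · exact ⟨b, a, he.symm, (hP b a he.symm).mpr ha⟩
      obtain ⟨f, hf, h1⟩ := ih _ (ncard_edgeSet_deleteEdges_singleton hab hH)
        (fun u v h => hP u v (SimpleGraph.deleteEdges_le _ h)) (L + 1)
      refine ⟨_, hf.cons_arc hab, fun u v h => ?_⟩
      by_cases h2 : u = a ∧ v = b
      · rw [h2.1]
        exact ha
      · apply h1 u v
        rw [arc, if_neg h2] at h
        split_ifs at h <;> linarith
  obtain ⟨f, hf, h1⟩ := main _ H rfl hP L
  have h2 : ∀ u v, P v → f u v ≤ 0 := by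
    intro u v hv
    by_contra h
    push Not at h
    exact (hP u v (hf.adj h.ne')).mp (h1 u v h) hv
  refine ⟨f, _, hf, fun v hv => Finset.sum_nonpos fun u _ => h2 u v hv,
    fun v hv => Finset.sum_nonneg fun u _ => ?_, fun u v hv huv => ?_⟩
  · by_contra h
    push Not at h
    have := hf.anti u v
    exact hv (h1 v u (by omega))
  · have h3 := Finset.single_le_sum (f := fun u => -f u v)
      (fun u _ => neg_nonneg.mpr (h2 u v hv)) (mem_univ u)
    rw [Finset.sum_neg_distrib, neg_le_neg_iff] at h3
    change vsum f v ≤ f u v at h3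
    have h4 := (hf.mem u v huv).1
    rw [abs_of_nonpos (h2 u v hv)] at h4
    linarith

/-- The graph that joins each vertex `v` of `S` to `π v`. -/
def pendantGraph {V : Type*} (S : Finset V) (π : V → V) (hπ : ∀ v ∈ S, π v ∉ S) :
    SimpleGraph V where
  Adj u v := (v ∈ S ∧ u = π v) ∨ (u ∈ S ∧ v = π u)
  symm := ⟨fun _ _ h => h.symm⟩
  loopless := ⟨fun u h => by rcases h with ⟨h, e⟩ | ⟨h, e⟩ <;> exact hπ u h (e ▸ h)⟩

/-- Sorted labeling of the edges from `S` to their partners, directed towards `S`: together with the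
partial sums `g` it makes the vertices of `S` pairwise distinct. -/
theorem exists_isSignedLabeling_pendantGraph [DecidableEq V] (S : Finset V) (π : V → V)
    (hπ : ∀ v ∈ S, π v ∉ S) (g : V → ℤ) (L : ℕ) :
    ∃ f, IsSignedLabeling (pendantGraph S π hπ) f L #S ∧
      (∀ v ∈ S, (L + 1 : ℤ) ≤ vsum f v ∧ vsum f v ≤ L + #S) ∧
      Set.InjOn (fun v => g v + vsum f v) S ∧
      ∀ v, v ∉ S → vsum f v ≤ -(#{w ∈ S | π w = v} * (L + 1 : ℤ)) := by
  obtain ⟨l, h1, h2, h3⟩ := exists_sorted_labels S g L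
  set f : V → V → ℤ := fun u v =>
    if v ∈ S ∧ u = π v then (l v : ℤ) else if u ∈ S ∧ v = π u then -(l u : ℤ) else 0 with hf
  have hex : ∀ u v, v ∈ S ∧ u = π v → ¬(u ∈ S ∧ v = π u) := by
    rintro u v ⟨h, rfl⟩ ⟨h', -⟩
    exact hπ v h h'
  have hpos : ∀ u v, 0 < f u v → v ∈ S ∧ u = π v ∧ f u v = l v := by
    intro u v h
    simp only [hf] at h ⊢
    split_ifs at h ⊢ with h4 h5
    · exact ⟨h4.1, h4.2, rfl⟩
    · omega
    · omega
  have hS : ∀ v ∈ S, vsum f v = l v := by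
    intro v hv
    rw [vsum, Finset.sum_eq_single (π v)]
    · simp [hf, hv]
    · intro u _ hu
      simp only [hf]
      rw [if_neg (fun h => hu h.2), if_neg]
      rintro ⟨h, rfl⟩
      exact hπ u h hv
    · simp
  refine ⟨f, ⟨fun u v => ?_, fun u v h => ?_, fun u v h => ?_, fun u v u' v' h h' => ?_,
    fun i h h' => ?_⟩, fun v hv => ?_, fun u hu v hv h => ?_, fun v hv => ?_⟩
  · simp only [hf]
    by_cases h4 : v ∈ S ∧ u = π v
    · rw [if_neg (hex _ _ h4), if_pos h4, if_pos h4]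
    · by_cases h5 : u ∈ S ∧ v = π u
      · rw [if_pos h5, if_neg h4, if_pos h5, neg_neg]
      · rw [if_neg h5, if_neg h4, if_neg h4, if_neg h5, neg_zero]
  · have h : ¬((v ∈ S ∧ u = π v) ∨ (u ∈ S ∧ v = π u)) := h
    rw [not_or] at h
    simp only [hf]
    rw [if_neg h.1, if_neg h.2]
  · rcases h with h | h
    · have := h1 v h.1
      simp only [hf]
      rw [if_pos h, Nat.abs_cast]
      omega
    · have := h1 u h.1
      simp only [hf]
      rw [if_neg fun h' => hex _ _ h' h, if_pos h, abs_neg, Nat.abs_cast]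
      omega
  · obtain ⟨h4, rfl, h5⟩ := hpos u v h
    obtain ⟨h6, rfl, h7⟩ := hpos u' v' (h' ▸ h)
    have : v = v' := h2 h4 h6 (by omega)
    subst this
    exact ⟨rfl, rfl⟩
  · have : Set.SurjOn l (S : Set V) (Finset.Ioc L (L + #S) : Finset ℕ) :=
      Finset.surjOn_of_injOn_of_card_le l
        (fun v hv => by
          have := h1 v hv
          simp only [coe_Ioc, Set.mem_Ioc]
          omega) h2 (by simp)
    obtain ⟨v, hv, hvi⟩ := this (by simp only [coe_Ioc, Set.mem_Ioc]; omega : i ∈ _)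
    refine ⟨π v, v, ?_⟩
    have hv : v ∈ S := hv
    simp [hf, hv, hvi]
  · have := h1 v hv
    rw [hS v hv]
    omega
  · refine h3 hu hv ?_
    simp only [hS u hu, hS v hv] at h
    exact h
  · have : vsum f v = ∑ u ∈ S with π u = v, -(l u : ℤ) := by
      rw [vsum, Finset.sum_filter, ← Finset.sum_subset (Finset.subset_univ S)]
      · refine Finset.sum_congr rfl fun u hu => ?_
        simp only [hf, hv, hu, false_and, if_false, true_and, eq_comm]
      · intro u _ hu
        simp [hf, hv, hu]
    rw [this, ← mul_neg, ← nsmul_eq_mul]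
    refine Finset.sum_le_card_nsmul _ _ _ fun u hu => ?_
    have := h1 u (Finset.mem_filter.mp hu).1
    omega

end Constructions

/-! ### Labelings from signed orders, and pullbacks -/

section Compression

variable {V : Type*} [Fintype V]

/-- The number of arcs of `t` along pairs in `r` whose weight is at most `n`. -/
def arcRank (r : V → V → Bool) (t : V → V → ℤ) (n : ℤ) : ℕ :=
  #{q : V × V | r q.1 q.2 = true ∧ 0 < t q.1 q.2 ∧ t q.1 q.2 ≤ n}

/-- The number of arcs of `t` along pairs in `r`, hence of edges of the graph `r`. -/
def arcCount (r : V → V → Bool) (t : V → V → ℤ) : ℕ :=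
  #{q : V × V | r q.1 q.2 = true ∧ 0 < t q.1 q.2}

/-- The signed labeling of the graph `r` with labels `L + 1, L + 2, …` whose directions and whose
order of labels are those of the signed weights `t`. -/
def compress (r : V → V → Bool) (t : V → V → ℤ) (L : ℕ) (u v : V) : ℤ :=
  if r u v = true then (t u v).sign * (L + arcRank r t |t u v|) else 0

theorem isSignedLabeling_compress {H : SimpleGraph V} {r : V → V → Bool} {t : V → V → ℤ}
    (hr : ∀ u v, H.Adj u v ↔ r u v = true) (anti : ∀ u v, t v u = -t u v)
    (ne : ∀ u v, u ≠ v → t u v ≠ 0)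
    (inj : ∀ u v u' v', 0 < t u v → t u v = t u' v' → u = u' ∧ v = v') (L : ℕ) :
    IsSignedLabeling H (compress r t L) L (arcCount r t) := by
  have hsymm : ∀ u v, r u v = r v u := fun u v => by
    rw [Bool.eq_iff_iff, ← hr, ← hr, H.adj_comm]
  have hle : ∀ n, arcRank r t n ≤ arcCount r t := fun n =>
    card_le_card fun q hq => by
      simp only [mem_filter, mem_univ, true_and] at hq ⊢
      exact ⟨hq.1, hq.2.1⟩
  have hlt : ∀ n u v, r u v = true → 0 < t u v → n < t u v →
      arcRank r t n < arcRank r t (t u v) := by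
    intro n u v h1 h2 h3
    refine card_lt_card ⟨fun q hq => ?_, fun h => ?_⟩
    · simp only [mem_filter, mem_univ, true_and] at hq ⊢
      exact ⟨hq.1, hq.2.1, by omega⟩
    · have hm : (u, v) ∈ ({q | r q.1 q.2 = true ∧ 0 < t q.1 q.2 ∧ t q.1 q.2 ≤ t u v} :
          Finset (V × V)) := by simp [h1, h2]
      have := h hm
      simp only [mem_filter, mem_univ, true_and] at this
      omega
  have hpos : ∀ u v, r u v = true → 0 < t u v → 0 < arcRank r t (t u v) := fun u v h1 h2 =>
    card_pos.mpr ⟨(u, v), by simp [h1, h2]⟩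
  have hval : ∀ u v, r u v = true → 0 < t u v →
      compress r t L u v = L + arcRank r t (t u v) := by
    intro u v h1 h2
    rw [compress, if_pos h1, Int.sign_eq_one_of_pos h2, one_mul, abs_of_pos h2]
  have hanti : ∀ u v, compress r t L v u = -compress r t L u v := by
    intro u v
    unfold compress
    rw [hsymm v u, anti u v, abs_neg, Int.sign_neg]
    split_ifs <;> ring
  have harc : ∀ u v, 0 < compress r t L u v → r u v = true ∧ 0 < t u v := by
    intro u v h
    unfold compress at h
    split_ifs at h with h1
    · exact ⟨h1, Int.sign_pos_iff.mp (pos_of_mul_pos_left h (by positivity))⟩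
    · omega
  refine ⟨hanti, fun u v h => ?_, fun u v h => ?_, fun u v u' v' h h' => ?_, fun i h h' => ?_⟩
  · rw [hr] at h
    rw [compress, if_neg h]
  · have main : ∀ u v, r u v = true → 0 < t u v →
        (L : ℤ) < |compress r t L u v| ∧ |compress r t L u v| ≤ L + arcCount r t := by
      intro u v h1 h2
      have h3 := hpos u v h1 h2
      have h4 := hle (t u v)
      rw [hval u v h1 h2, abs_of_pos (by omega)]
      omega
    rw [hr] at h
    rcases lt_or_gt_of_ne (ne u v ((hr u v).mpr h).ne) with h1 | h1
    · have := main v u (by rwa [hsymm]) (by rw [anti u v]; omega)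
      rwa [hanti u v, abs_neg] at this
    · exact main u v h h1
  · obtain ⟨h1, h2⟩ := harc u v h
    obtain ⟨h3, h4⟩ := harc u' v' (h' ▸ h)
    rw [hval u v h1 h2, hval u' v' h3 h4] at h'
    rcases lt_trichotomy (t u v) (t u' v') with h5 | h5 | h5
    · have := hlt _ _ _ h3 h4 h5
      omega
    · exact inj u v u' v' h2 h5
    · have := hlt _ _ _ h1 h2 h5
      omega
  · set Q : Finset (V × V) := {q | r q.1 q.2 = true ∧ 0 < t q.1 q.2} with hQ
    have hsurj : Set.SurjOn (fun q : V × V => arcRank r t (t q.1 q.2)) (Q : Set (V × V))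
        (Finset.Ioc 0 (arcCount r t) : Finset ℕ) := by
      refine Finset.surjOn_of_injOn_of_card_le _ (fun q hq => ?_) (fun q hq q' hq' h => ?_) ?_
      · simp only [hQ, coe_filter, mem_univ, true_and, Set.mem_ofPred_eq] at hq
        simp only [coe_Ioc, Set.mem_Ioc]
        exact ⟨hpos _ _ hq.1 hq.2, hle _⟩
      · simp only [hQ, coe_filter, mem_univ, true_and, Set.mem_ofPred_eq] at hq hq'
        rcases lt_trichotomy (t q.1 q.2) (t q'.1 q'.2) with h5 | h5 | h5
        · have := hlt _ _ _ hq'.1 hq'.2 h5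
          omega
        · have := inj _ _ _ _ hq.2 h5
          exact Prod.ext this.1 this.2
        · have := hlt _ _ _ hq.1 hq.2 h5
          omega
      · simp [arcCount, hQ]
    obtain ⟨q, hq, hqi⟩ := hsurj (by
      simp only [coe_Ioc, Set.mem_Ioc]; omega : i - L ∈ _)
    simp only [hQ, coe_filter, mem_univ, true_and, Set.mem_ofPred_eq] at hq
    refine ⟨q.1, q.2, ?_⟩
    rw [hval _ _ hq.1 hq.2]
    simp only at hqi
    omega

/-- A signed labeling of `H'` is pulled back along a map that identifies `H` with `H'` up to
isolated vertices. -/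
theorem IsSignedLabeling.pullback {U : Type*} [Fintype U] {H : SimpleGraph V} {H' : SimpleGraph U}
    {f : U → U → ℤ} {L m : ℕ} (hf : IsSignedLabeling H' f L m) (e : V → U) (B : Finset V)
    (he : Set.InjOn e B) (hB : ∀ u v, H.Adj u v → u ∈ B ∧ v ∈ B)
    (hH : ∀ u ∈ B, ∀ v ∈ B, H.Adj u v ↔ H'.Adj (e u) (e v))
    (hsurj : ∀ i j, H'.Adj i j → ∃ u ∈ B, e u = i) :
    ∃ f', IsSignedLabeling H f' L m ∧ ∀ v ∈ B, vsum f' v = vsum f (e v) := by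
  classical
  have hpos : ∀ u v, (if u ∈ B ∧ v ∈ B then f (e u) (e v) else 0) ≠ 0 → u ∈ B ∧ v ∈ B := by
    intro u v h
    by_contra h'
    exact h (if_neg h')
  refine ⟨fun u v => if u ∈ B ∧ v ∈ B then f (e u) (e v) else 0,
    ⟨fun u v => ?_, fun u v h => ?_, fun u v h => ?_, fun u v u' v' h h' => ?_,
      fun i h h' => ?_⟩, fun v hv => ?_⟩
  · by_cases h : u ∈ B ∧ v ∈ B
    · rw [if_pos h, if_pos h.symm, hf.anti (e u)]
    · rw [if_neg h, if_neg fun h' => h h'.symm, neg_zero]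
  · split_ifs with h1
    · rw [hH u h1.1 v h1.2] at h
      exact hf.zero _ _ h
    · rfl
  · have h1 := hB u v h
    rw [if_pos h1]
    exact hf.mem _ _ ((hH u h1.1 v h1.2).mp h)
  · have h1 := hpos u v h.ne'
    have h2 := hpos u' v' (h' ▸ h.ne')
    rw [if_pos h1] at h h'
    rw [if_pos h2] at h'
    have := hf.inj _ _ _ _ h h'
    exact ⟨he h1.1 h2.1 this.1, he h1.2 h2.2 this.2⟩
  · obtain ⟨j, k, hjk⟩ := hf.surj i h h'
    have ha : H'.Adj j k := hf.adj (by rw [hjk]; exact_mod_cast (by omega : i ≠ 0))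
    obtain ⟨u, hu, rfl⟩ := hsurj _ _ ha
    obtain ⟨v, hv, rfl⟩ := hsurj _ _ ha.symm
    exact ⟨u, v, by rw [if_pos ⟨hu, hv⟩, hjk]⟩
  · unfold vsum
    simp only [hv, and_true]
    rw [← Finset.sum_filter, Finset.filter_univ_mem, ← Finset.sum_image (f := fun i => f i (e v))
      (fun u hu w hw h => he hu hw h)]
    refine Finset.sum_subset (Finset.subset_univ _) fun i _ hi => hf.zero _ _ fun h => hi ?_
    obtain ⟨u, hu, rfl⟩ := hsurj _ _ h
    exact Finset.mem_image_of_mem e hu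

end Compression

/-! ### Graphs on four vertices -/

section FourVertices

/-- The antisymmetric matrix with the given entries above the diagonal. -/
def skew (a b c d e f : ℤ) : Fin 4 → Fin 4 → ℤ :=
  ![![0, a, b, c], ![-a, 0, d, e], ![-b, -d, 0, f], ![-c, -e, -f, 0]]

/-- The symmetric matrix with zero diagonal and the given entries above it. -/
def symm4 (a b c d e f : Bool) : Fin 4 → Fin 4 → Bool :=
  ![![false, a, b, c], ![a, false, d, e], ![b, d, false, f], ![c, e, f, false]]

/-- Every vertex set of `r` that avoids the first `p` vertices (at least the vertex `0`) and is
closed under adjacency consists of isolated vertices. -/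
def Rooted (p : ℕ) (r : Fin 4 → Fin 4 → Bool) : Prop :=
  ∀ x y z : Bool, (∀ i : Fin 4, i.val < p → ![false, x, y, z] i = false) →
    (∀ i j, ![false, x, y, z] i = true → r i j = true → ![false, x, y, z] j = true) →
    ∀ i j, ![false, x, y, z] i = true → r i j = false

instance (p : ℕ) (r : Fin 4 → Fin 4 → Bool) : Decidable (Rooted p r) := by
  unfold Rooted
  infer_instance

/-- The vertex `i` is not isolated in `r`. -/
def Active (r : Fin 4 → Fin 4 → Bool) (i : Fin 4) : Prop := ∃ j, r i j = true

instance (r : Fin 4 → Fin 4 → Bool) (i : Fin 4) : Decidable (Active r i) := by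
  unfold Active
  infer_instance

/-- The vertex-sum of `i`, in a form that evaluates quickly. -/
def colSum (F : Fin 4 → Fin 4 → ℤ) (i : Fin 4) : ℤ := F 0 i + F 1 i + F 2 i + F 3 i

theorem vsum_eq_colSum (F : Fin 4 → Fin 4 → ℤ) (i : Fin 4) : vsum F i = colSum F i := by
  rw [vsum, Fin.sum_univ_four, colSum]

/-- In the labeling of `r` given by the order `t`, the active vertices from `p` on have distinct
sums that are at most `p`, and any amount above the number of labels that is subtracted from the
sum of one of the first `p` vertices brings it below all of them. -/
def Separated (p : ℕ) (r : Fin 4 → Fin 4 → Bool) (t : Fin 4 → Fin 4 → ℤ) : Prop :=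
  ∀ i : Fin 4, (i.val < p → colSum (compress r t 0) i ≤ arcCount r t) ∧
    (p ≤ i.val → Active r i → colSum (compress r t 0) i ≤ p ∧
      ∀ j : Fin 4, (j.val < p → colSum (compress r t 0) j ≤
        arcCount r t + colSum (compress r t 0) i) ∧
        (p ≤ j.val → Active r j → i ≠ j → colSum (compress r t 0) i ≠ colSum (compress r t 0) j))

instance (p : ℕ) (r : Fin 4 → Fin 4 → Bool) (t : Fin 4 → Fin 4 → ℤ) :
    Decidable (Separated p r t) := by
  unfold Separated
  infer_instance

/-- In the labeling of `r` by `L + 1, …, L + h` given by the order `t`, the vertex `0` and the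
active vertices have distinct sums that are at most `δ`, once `R` has been subtracted at the vertex `0`. -/
def RootSeparated (h : ℕ) (r : Fin 4 → Fin 4 → Bool) (t : Fin 4 → Fin 4 → ℤ) (L R δ : ℕ) : Prop :=
  arcCount r t = h ∧ ∀ i, (i = 0 ∨ Active r i) →
    colSum (compress r t L) i - (if i = 0 then (R : ℤ) else 0) ≤ δ ∧
    ∀ j, (j = 0 ∨ Active r j) → i ≠ j → colSum (compress r t L) i - (if i = 0 then (R : ℤ) else 0) ≠
      colSum (compress r t L) j - (if j = 0 then (R : ℤ) else 0)

instance (h : ℕ) (r : Fin 4 → Fin 4 → Bool) (t : Fin 4 → Fin 4 → ℤ) (L R δ : ℕ) :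
    Decidable (RootSeparated h r t L R δ) := by
  unfold RootSeparated
  infer_instance

/-- Weights whose labelings serve all graphs with the single root `0`. -/
def orders₁ : List (Fin 4 → Fin 4 → ℤ) :=
  [skew (-1) (-3) (-5) (-2) 6 (-4), skew (-5) (-1) (-3) 2 (-6) 4, skew (-6) (-4) 1 5 (-2) (-3),
    skew (-5) (-2) 1 (-6) 3 (-4), skew 1 2 (-3) (-4) (-5) (-6)]

/-- Weights whose labelings serve all graphs with the roots `0` and `1`. -/
def orders₂ : List (Fin 4 → Fin 4 → ℤ) :=
  [skew (-5) 1 3 2 (-6) 4, skew (-1) 6 (-5) (-4) 2 3, skew 5 (-1) 6 (-2) 3 (-4),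
    skew (-1) (-2) 5 6 (-4) 3, skew (-1) (-2) 5 (-4) 3 (-6)]

/-- Weights whose labelings serve all graphs with the roots `0`, `1` and `2`. -/
def orders₃ : List (Fin 4 → Fin 4 → ℤ) :=
  [skew (-4) 5 1 (-6) 2 3, skew (-1) (-2) 3 (-4) 5 (-6)]

/-- The number of edges of `r`. -/
def edgeCount4 (r : Fin 4 → Fin 4 → Bool) : ℕ := arcCount r (skew 1 2 3 4 5 6)

theorem separated_three : ∀ a b c d e f : Bool, Rooted 3 (symm4 a b c d e f) →
    ∃ t ∈ orders₃, Separated 3 (symm4 a b c d e f) t := by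
  decide +kernel

theorem separated_two : ∀ a b c d e f : Bool, Rooted 2 (symm4 a b c d e f) →
    ∃ t ∈ orders₂, Separated 2 (symm4 a b c d e f) t := by
  decide +kernel

/-- Subtracting `R < 24` at the root. For a few small `R` the labels `1, …, h` do not suffice; then
`R - h, …, R - 1` do, and they allow the larger bound `h + 1` for the sums. -/
theorem rootSeparated_small : ∀ a b c d e f : Bool, Rooted 1 (symm4 a b c d e f) →
    ∀ R ∈ List.range 24, edgeCount4 (symm4 a b c d e f) < R →
      (∃ t ∈ orders₁, RootSeparated (edgeCount4 (symm4 a b c d e f)) (symm4 a b c d e f) t 0 R 1) ∨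
      (R ≤ 2 * edgeCount4 (symm4 a b c d e f) + 2 ∧
        ∃ t ∈ orders₁, RootSeparated (edgeCount4 (symm4 a b c d e f)) (symm4 a b c d e f) t
          (R - edgeCount4 (symm4 a b c d e f) - 1) R (edgeCount4 (symm4 a b c d e f) + 1)) := by
  decide +kernel

/-- Subtracting `23` at the root already brings it below all other vertices, so that the same
labeling serves every larger amount. -/
theorem rootSeparated_large : ∀ a b c d e f : Bool, Rooted 1 (symm4 a b c d e f) →
    ∃ t ∈ orders₁, RootSeparated (edgeCount4 (symm4 a b c d e f)) (symm4 a b c d e f) t 0 23 1 ∧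
      ∀ i, colSum (compress (symm4 a b c d e f) t 0) 0 <
        23 + colSum (compress (symm4 a b c d e f) t 0) i := by
  decide +kernel

end FourVertices

/-! ### The graph induced by the non-neighbours -/

section Model

/-- The signed weights `t` are an antisymmetric matrix with distinct nonzero values on the pairs. -/
def IsSignedOrder (t : Fin 4 → Fin 4 → ℤ) : Prop :=
  (∀ u v, t v u = -t u v) ∧ (∀ u v, u ≠ v → t u v ≠ 0) ∧
    ∀ u v u' v', 0 < t u v → t u v = t u' v' → u = u' ∧ v = v'

instance (t : Fin 4 → Fin 4 → ℤ) : Decidable (IsSignedOrder t) := by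
  unfold IsSignedOrder
  infer_instance

theorem isSignedOrder_of_mem : ∀ t ∈ orders₁ ++ orders₂ ++ orders₃, IsSignedOrder t := by
  decide +kernel

/-- An enumeration of at most four vertices that starts with those of `W`. -/
theorem exists_enumeration {V : Type*} [DecidableEq V] (B W : Finset V) (hW : W ⊆ B) (hB : #B ≤ 4) :
    ∃ e : V → Fin 4, Set.InjOn e B ∧ ∀ v ∈ B, (e v).val < #W ↔ v ∈ W := by
  have hcard : #(B \ W) + #W = #B := card_sdiff_add_card_eq_card hW
  have hlt : ∀ (S : Finset V) (v : V) (h : v ∈ S), (S.equivFin ⟨v, h⟩).val < #S :=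
    fun S v h => (S.equivFin ⟨v, h⟩).isLt
  let n : V → ℕ := fun v => if h : v ∈ W then (W.equivFin ⟨v, h⟩).val
    else if h : v ∈ B \ W then #W + ((B \ W).equivFin ⟨v, h⟩).val else 0
  have hnW : ∀ v (h : v ∈ W), n v = (W.equivFin ⟨v, h⟩).val := fun v h => dif_pos h
  have hnZ : ∀ v (h : v ∈ B \ W), n v = #W + ((B \ W).equivFin ⟨v, h⟩).val := fun v h => by
    simp only [n]
    rw [dif_neg (mem_sdiff.mp h).2, dif_pos h]
  have hn4 : ∀ v ∈ B, n v < 4 := by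
    intro v hv
    by_cases h : v ∈ W
    · have := hlt _ v h
      rw [hnW v h]
      omega
    · have h' := mem_sdiff.mpr ⟨hv, h⟩
      have := hlt _ v h'
      rw [hnZ v h']
      omega
  have hiff : ∀ v ∈ B, n v < #W ↔ v ∈ W := by
    intro v hv
    by_cases h : v ∈ W
    · simp only [h, iff_true]
      rw [hnW v h]
      exact hlt _ v h
    · simp only [h, iff_false]
      rw [hnZ v (mem_sdiff.mpr ⟨hv, h⟩)]
      omega
  have hinj : Set.InjOn n B := by
    intro u hu v hv huv
    have hu : u ∈ B := hu
    have hv : v ∈ B := hv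
    by_cases h : u ∈ W
    · have h' : v ∈ W := by rw [← hiff v hv, ← huv, hiff u hu]; exact h
      rw [hnW u h, hnW v h'] at huv
      simpa using W.equivFin.injective (Fin.ext huv)
    · have h' : v ∉ W := by rw [← hiff v hv, ← huv, hiff u hu]; exact h
      rw [hnZ u (mem_sdiff.mpr ⟨hu, h⟩), hnZ v (mem_sdiff.mpr ⟨hv, h'⟩)] at huv
      simpa using (B \ W).equivFin.injective (Fin.ext (Nat.add_left_cancel huv))
  refine ⟨fun v => if h : n v < 4 then ⟨n v, h⟩ else 0, fun u hu v hv huv => ?_, fun v hv => ?_⟩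
  · simp only [dif_pos (hn4 u hu), dif_pos (hn4 v hv), Fin.mk.injEq] at huv
    exact hinj hu hv huv
  · simp only [dif_pos (hn4 v hv)]
    exact hiff v hv

variable {V : Type*} [Fintype V] [DecidableEq V]

/-- A graph on at most four vertices, every vertex of which is connected to `W`, is copied to
`Fin 4`, with `W` sent to the first vertices. -/
theorem exists_model (H : SimpleGraph V) (B W : Finset V) (hW : W ⊆ B) (hB : #B ≤ 4)
    (hH : ∀ u v, H.Adj u v → u ∈ B ∧ v ∈ B)
    (hconn : ∀ C ⊆ B \ W, (∀ u ∈ C, ∀ v, H.Adj u v → v ∈ C) → C = ∅) :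
    ∃ (e : V → Fin 4) (r : Fin 4 → Fin 4 → Bool),
      (∃ b₁ b₂ b₃ b₄ b₅ b₆, r = symm4 b₁ b₂ b₃ b₄ b₅ b₆) ∧ Set.InjOn e B ∧
      (∀ v ∈ B, (e v).val < #W ↔ v ∈ W) ∧ Rooted #W r ∧
      (∀ z ∈ B \ W, Active r (e z)) ∧
      ∀ t L, IsSignedOrder t → ∃ f,
        IsSignedLabeling H f L (arcCount r t) ∧
        ∀ v ∈ B, vsum f v = colSum (compress r t L) (e v) := by
  classical
  obtain ⟨e, he, heW⟩ := exists_enumeration B W hW hB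
  let H' : SimpleGraph (Fin 4) :=
    { Adj := fun i j => ∃ u ∈ B, ∃ v ∈ B, e u = i ∧ e v = j ∧ H.Adj u v
      symm := ⟨fun i j ⟨u, hu, v, hv, h1, h2, h3⟩ => ⟨v, hv, u, hu, h2, h1, h3.symm⟩⟩
      loopless := ⟨fun i ⟨u, hu, v, hv, h1, h2, h3⟩ => h3.ne (he hu hv (h1.trans h2.symm))⟩ }
  have hH' : ∀ u ∈ B, ∀ v ∈ B, H.Adj u v ↔ H'.Adj (e u) (e v) := by
    intro u hu v hv
    refine ⟨fun h => ⟨u, hu, v, hv, rfl, rfl, h⟩, ?_⟩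
    rintro ⟨u', hu', v', hv', h1, h2, h3⟩
    rwa [he hu' hu h1, he hv' hv h2] at h3
  obtain ⟨r, hr⟩ : ∃ r, r = symm4 (decide (H'.Adj 0 1)) (decide (H'.Adj 0 2)) (decide (H'.Adj 0 3))
    (decide (H'.Adj 1 2)) (decide (H'.Adj 1 3)) (decide (H'.Adj 2 3)) := ⟨_, rfl⟩
  have hadj : ∀ i j, H'.Adj i j ↔ r i j = true := by
    intro i j
    fin_cases i <;> fin_cases j <;>
      simp [hr, symm4, H'.adj_comm 1 0, H'.adj_comm 2 0, H'.adj_comm 3 0, H'.adj_comm 2 1,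
        H'.adj_comm 3 1, H'.adj_comm 3 2]
  refine ⟨e, r, ⟨_, _, _, _, _, _, hr⟩, he, heW, fun x y z h1 h2 i j hi => ?_, fun z hz => ?_,
    fun t L ht => ?_⟩
  · by_contra hij
    rw [Bool.not_eq_false] at hij
    obtain ⟨u, hu, v, hv, rfl, rfl, -⟩ := (hadj i j).mpr hij
    have hC := hconn (B.filter fun v => ![false, x, y, z] (e v) = true) (fun w hw => ?_)
      (fun w hw w' hww' => ?_)
    · rw [Finset.filter_eq_empty_iff] at hC
      exact hC hu hi
    · rw [mem_filter] at hw
      refine mem_sdiff.mpr ⟨hw.1, fun h => ?_⟩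
      rw [h1 _ ((heW w hw.1).mpr h)] at hw
      exact absurd hw.2 (by simp)
    · rw [mem_filter] at hw ⊢
      have hw' := (hH w w' hww').2
      exact ⟨hw', h2 _ _ hw.2 ((hadj _ _).mp ((hH' w hw.1 w' hw').mp hww'))⟩
  · by_contra hact
    have hzB := (mem_sdiff.mp hz).1
    have := hconn {z} (by simpa using hz) (fun u hu v huv => by
      rw [mem_singleton] at hu
      subst hu
      exact absurd ⟨e v, (hadj _ _).mp ((hH' u hzB v (hH u v huv).2).mp huv)⟩ hact)
    exact absurd this (Finset.singleton_ne_empty z)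
  · obtain ⟨f, hf, hs⟩ := (isSignedLabeling_compress hadj ht.1 ht.2.1 ht.2.2 L).pullback e B
      he hH hH' (fun i j ⟨u, hu, _, _, h, _⟩ => ⟨u, hu, h⟩)
    exact ⟨f, hf, fun v hv => by rw [hs v hv, vsum_eq_colSum]⟩

/-- If all of `B` is in `W`, or `W` has at least two vertices, some labeling by `1, …, h` keeps the
sums outside `W` distinct and at most `#W`, and keeps the sums in `W` so small that they fall below
all others when more than `h` is subtracted. -/
theorem exists_separated (H : SimpleGraph V) (B W : Finset V) (hW : W ⊆ B) (hB : #B ≤ 4)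
    (hW1 : B \ W = ∅ ∨ 2 ≤ #W) (hH : ∀ u v, H.Adj u v → u ∈ B ∧ v ∈ B)
    (hconn : ∀ C ⊆ B \ W, (∀ u ∈ C, ∀ v, H.Adj u v → v ∈ C) → C = ∅) :
    ∃ f h, IsSignedLabeling H f 0 h ∧ Set.InjOn (vsum f) (B \ W : Finset V) ∧
      (∀ z ∈ B \ W, vsum f z ≤ #W) ∧ (∀ w ∈ W, vsum f w ≤ h) ∧
      ∀ w ∈ W, ∀ z ∈ B \ W, vsum f w ≤ h + vsum f z := by
  by_cases hZ : B \ W = ∅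
  · obtain ⟨h, hh⟩ := exists_isSignedLabeling_neg_le_vsum H
    obtain ⟨f, hf, hs⟩ := hh 0
    refine ⟨_, h, hf.neg, by simp [hZ], by simp [hZ], fun w _ => ?_, by simp [hZ]⟩
    have := hs w
    rw [vsum_neg]
    push_cast at this
    linarith
  have hZ0 : 0 < #(B \ W) := card_pos.mpr (Finset.nonempty_iff_ne_empty.mpr hZ)
  have hcard : #(B \ W) + #W = #B := card_sdiff_add_card_eq_card hW
  replace hW1 := hW1.resolve_left hZ
  obtain ⟨e, r, ⟨b₁, b₂, b₃, b₄, b₅, b₆, hr⟩, he, heW, hroot, hact, hlab⟩ :=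
    exists_model H B W hW hB hH hconn
  obtain ⟨t, ht, hsep⟩ : ∃ t, IsSignedOrder t ∧ Separated #W r t := by
    subst hr
    rcases (by omega : #W = 2 ∨ #W = 3) with h | h <;> rw [h] at hroot ⊢
    · obtain ⟨t, ht, hs⟩ := separated_two _ _ _ _ _ _ hroot
      exact ⟨t, isSignedOrder_of_mem t (by simp [ht]), hs⟩
    · obtain ⟨t, ht, hs⟩ := separated_three _ _ _ _ _ _ hroot
      exact ⟨t, isSignedOrder_of_mem t (by simp [ht]), hs⟩
  obtain ⟨f, hf, hs⟩ := hlab t 0 ht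
  have hZmem : ∀ z ∈ B \ W, z ∈ B ∧ #W ≤ (e z).val := fun z hz => by
    rw [mem_sdiff] at hz
    refine ⟨hz.1, ?_⟩
    rw [← not_lt, heW z hz.1]
    exact hz.2
  refine ⟨f, _, hf, fun u hu v hv huv => ?_, fun z hz => ?_, fun w hw => ?_, fun w hw z hz => ?_⟩
  · have hu' := hZmem u hu
    have hv' := hZmem v hv
    rw [hs u hu'.1, hs v hv'.1] at huv
    by_contra hne
    exact (((hsep (e u)).2 hu'.2 (hact u hu)).2 (e v)).2 hv'.2 (hact v hv)
      (fun h => hne (he hu'.1 hv'.1 h)) huv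
  · have hz' := hZmem z hz
    rw [hs z hz'.1]
    exact ((hsep (e z)).2 hz'.2 (hact z hz)).1
  · rw [hs w (hW hw)]
    exact (hsep (e w)).1 ((heW w (hW hw)).mpr hw)
  · have hz' := hZmem z hz
    rw [hs z hz'.1, hs w (hW hw)]
    exact (((hsep (e z)).2 hz'.2 (hact z hz)).2 (e w)).1 ((heW w (hW hw)).mpr hw)

/-- If `W = {w}`, then for each amount `R > h` to be subtracted at `w` there is a labeling by
`1, …, h`, or, if `R ≤ 2 * h + 2`, one by `R - h, …, R - 1`, with distinct small sums. -/
theorem exists_rootSeparated (H : SimpleGraph V) (B : Finset V) (w : V) (hw : w ∈ B) (hB : #B ≤ 4)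
    (hH : ∀ u v, H.Adj u v → u ∈ B ∧ v ∈ B)
    (hconn : ∀ C ⊆ B \ {w}, (∀ u ∈ C, ∀ v, H.Adj u v → v ∈ C) → C = ∅) :
    ∃ h, ∀ R : ℕ, h < R → ∃ f L δ, IsSignedLabeling H f L h ∧
      (L = 0 ∧ δ = 1 ∨ R ≤ 2 * h + 2 ∧ L = R - h - 1 ∧ δ = h + 1) ∧
      Set.InjOn (fun v => vsum f v - if v = w then (R : ℤ) else 0) B ∧
      ∀ v ∈ B, vsum f v - (if v = w then (R : ℤ) else 0) ≤ δ := by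
  obtain ⟨e, r, ⟨b₁, b₂, b₃, b₄, b₅, b₆, hr⟩, he, heW, hroot, hact, hlab⟩ :=
    exists_model H B {w} (by simpa using hw) hB hH hconn
  rw [card_singleton] at hroot
  simp only [card_singleton, mem_singleton] at heW
  have hzero : ∀ v ∈ B, e v = 0 ↔ v = w := fun v hv => by
    rw [← heW v hv, Nat.lt_one_iff, Fin.ext_iff, Fin.val_zero]
  have hact' : ∀ v ∈ B, e v = 0 ∨ Active r (e v) := fun v hv => by
    by_cases h : v = w
    · exact Or.inl ((hzero v hv).mpr h)
    · exact Or.inr (hact v (by simp [hv, h]))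
  have main : ∀ t L R δ, IsSignedOrder t → RootSeparated (edgeCount4 r) r t L R δ →
      ∃ f, IsSignedLabeling H f L (edgeCount4 r) ∧
      Set.InjOn (fun v => vsum f v - if v = w then (R : ℤ) else 0) B ∧
      ∀ v ∈ B, vsum f v - (if v = w then (R : ℤ) else 0) ≤ δ := by
    intro t L R δ ht hsep
    obtain ⟨f, hf, hs⟩ := hlab t L ht
    rw [hsep.1] at hf
    refine ⟨f, hf, fun u hu v hv huv => ?_, fun v hv => ?_⟩
    · simp only [hs u hu, hs v hv, ← hzero u hu, ← hzero v hv] at huv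
      by_contra hne
      exact (hsep.2 (e u) (hact' u hu)).2 (e v) (hact' v hv) (fun h => hne (he hu hv h)) huv
    · simp only [hs v hv, ← hzero v hv]
      exact (hsep.2 (e v) (hact' v hv)).1
  refine ⟨edgeCount4 r, fun R hR => ?_⟩
  by_cases hR' : R < 24
  · subst hr
    rcases rootSeparated_small _ _ _ _ _ _ hroot R (List.mem_range.mpr hR') hR with
      ⟨t, ht, hs⟩ | ⟨hR2, t, ht, hs⟩
    · obtain ⟨f, h1, h2, h3⟩ := main t _ _ _ (isSignedOrder_of_mem t (by simp [ht])) hs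
      exact ⟨f, _, _, h1, Or.inl ⟨rfl, rfl⟩, h2, h3⟩
    · obtain ⟨f, h1, h2, h3⟩ := main t _ _ _ (isSignedOrder_of_mem t (by simp [ht])) hs
      exact ⟨f, _, _, h1, Or.inr ⟨hR2, rfl, rfl⟩, h2, h3⟩
  · obtain ⟨t, ht, hs, hlarge⟩ : ∃ t ∈ orders₁, RootSeparated (edgeCount4 r) r t 0 23 1 ∧
        ∀ i, colSum (compress r t 0) 0 < 23 + colSum (compress r t 0) i := by
      subst hr
      exact rootSeparated_large _ _ _ _ _ _ hroot
    -- for large `R` the sum at `w` is below all others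
    have hs' : RootSeparated (edgeCount4 r) r t 0 R 1 := by
      refine ⟨hs.1, fun i hi => ?_⟩
      have h1 := hs.2 i hi
      have h2 := hlarge i
      refine ⟨?_, fun j hj hij => ?_⟩
      · have := h1.1
        split_ifs at this ⊢ <;> omega
      · have h3 := h1.2 j hj hij
        have h4 := hlarge j
        by_cases hi0 : i = 0
        · subst hi0
          rw [if_pos rfl, if_neg (Ne.symm hij)]
          omega
        · by_cases hj0 : j = 0
          · subst hj0
            rw [if_pos rfl, if_neg hij]
            omega
          · rw [if_neg hi0, if_neg hj0] at h3 ⊢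
            exact h3
    obtain ⟨f, h1, h2, h3⟩ := main t _ _ _ (isSignedOrder_of_mem t (by simp [ht])) hs'
    exact ⟨f, _, _, h1, Or.inl ⟨rfl, rfl⟩, h2, h3⟩

end Model

/-! ### Combination of the parts -/

section Layers

variable {V : Type*}

/-- The edges of `K` with both ends in `S`. -/
def within (K : SimpleGraph V) (S : Finset V) : SimpleGraph V where
  Adj u v := K.Adj u v ∧ u ∈ S ∧ v ∈ S
  symm := ⟨fun _ _ h => ⟨h.1.symm, h.2.2, h.2.1⟩⟩
  loopless := ⟨fun _ h => h.1.ne rfl⟩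

/-- The edges of `K` between `A` and `B` that are not in `R`. -/
def crossing (K R : SimpleGraph V) (A B : Finset V) : SimpleGraph V where
  Adj u v := K.Adj u v ∧ (u ∈ A ∧ v ∈ B ∨ u ∈ B ∧ v ∈ A) ∧ ¬R.Adj u v
  symm := ⟨fun _ _ h => ⟨h.1.symm, h.2.1.symm.imp And.symm And.symm, fun h' => h.2.2 h'.symm⟩⟩
  loopless := ⟨fun _ h => h.1.ne rfl⟩

/-- Signed labelings of the four parts of a graph on `A ∪ B` combine to one of the whole graph. -/
theorem IsSignedLabeling.assemble {K : SimpleGraph V} {A B W : Finset V} (hAB : Disjoint A B)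
    (hK : ∀ u v, K.Adj u v → u ∈ A ∨ u ∈ B) (hW : W ⊆ B) {α : V → V} (hα : ∀ v ∈ W, α v ∉ W)
    (hαA : ∀ w ∈ W, α w ∈ A ∧ K.Adj w (α w)) {fI fU fR : V → V → ℤ} {n mU p : ℕ}
    (hI : IsSignedLabeling (within K A ⊔ within K B) fI 0 n)
    (hU : IsSignedLabeling (crossing K (pendantGraph W α hα) A B) fU n mU)
    (hR : IsSignedLabeling (pendantGraph W α hα) fR (n + mU) p) :
    IsSignedLabeling K (fun u v => fI u v + fU u v + fR u v) 0 (n + mU + p) := by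
  have hdis : ∀ v, v ∈ A → v ∉ B := fun v h h' => Finset.disjoint_left.mp hAB h h'
  have hpend : ∀ u v, (pendantGraph W α hα).Adj u v →
      K.Adj u v ∧ (u ∈ A ∧ v ∈ B ∨ u ∈ B ∧ v ∈ A) := by
    rintro u v (⟨h, rfl⟩ | ⟨h, rfl⟩)
    · exact ⟨(hαA v h).2.symm, Or.inl ⟨(hαA v h).1, hW h⟩⟩
    · exact ⟨(hαA u h).2, Or.inr ⟨hW h, (hαA u h).1⟩⟩
  have hIU : ∀ u v, (within K A ⊔ within K B).Adj u v →
      ¬(u ∈ A ∧ v ∈ B ∨ u ∈ B ∧ v ∈ A) := by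
    rintro u v (⟨-, h1, h2⟩ | ⟨-, h1, h2⟩) (⟨h3, h4⟩ | ⟨h3, h4⟩)
    · exact hdis v h2 h4
    · exact hdis u h1 h3
    · exact hdis u h3 h1
    · exact hdis v h4 h2
  have h1 := hI.sup (by rwa [zero_add])
    (fun u v h (h' : (crossing K (pendantGraph W α hα) A B).Adj u v) => hIU u v h h'.2.1)
  have h2 := h1.sup (by rwa [zero_add]) (fun u v h h' => by
    rcases h with h | h
    · exact hIU u v h (hpend u v h').2
    · exact h.2.2 h')
  have hsup : (within K A ⊔ within K B) ⊔ crossing K (pendantGraph W α hα) A B ⊔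
      pendantGraph W α hα = K := by
    ext u v
    constructor
    · rintro (((h | h) | h) | h)
      · exact h.1
      · exact h.1
      · exact h.1
      · exact (hpend u v h).1
    · intro h
      by_cases hR' : (pendantGraph W α hα).Adj u v
      · exact Or.inr hR'
      · rcases hK u v h with hu | hu <;> rcases hK v u h.symm with hv | hv
        · exact Or.inl (Or.inl (Or.inl ⟨h, hu, hv⟩))
        · exact Or.inl (Or.inr ⟨h, Or.inl ⟨hu, hv⟩, hR'⟩)
        · exact Or.inl (Or.inr ⟨h, Or.inr ⟨hu, hv⟩, hR'⟩)
        · exact Or.inl (Or.inl (Or.inr ⟨h, hu, hv⟩))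
  rwa [hsup] at h2

variable [Fintype V] [DecidableEq V]

/-- The labeling of everything except the star at a vertex of maximum degree, where `A` consists of
the neighbours of that vertex and `B` of the other vertices: the sums in `B` are distinct and at
most `δ`, and those in `A` exceed `δ` once each of them receives a label above `M`. -/
theorem exists_labeling_off_star (K : SimpleGraph V) (A B : Finset V) (hAB : Disjoint A B)
    (hK : ∀ u v, K.Adj u v → u ∈ A ∨ u ∈ B) (hB : #B ≤ 4)
    (hconn : ∀ C ⊆ B, (∀ u ∈ C, ∀ v, K.Adj u v → v ∈ C) → C = ∅) :
    ∃ (f : V → V → ℤ) (M δ : ℕ), IsSignedLabeling K f 0 M ∧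
      (∀ a ∈ A, (δ : ℤ) - M ≤ vsum f a) ∧ (∀ b ∈ B, vsum f b ≤ δ) ∧ Set.InjOn (vsum f) B := by
  classical
  have hdis : ∀ v, v ∈ A → v ∉ B := fun v h h' => Finset.disjoint_left.mp hAB h h'
  set W := B.filter fun b => ∃ a ∈ A, K.Adj b a with hWdef
  have hW : W ⊆ B := filter_subset _ _
  have hαex : ∀ w, ∃ a, w ∈ W → a ∈ A ∧ K.Adj w a := by
    intro w
    by_cases h : w ∈ W
    · obtain ⟨a, ha⟩ := (mem_filter.mp h).2
      exact ⟨a, fun _ => ha⟩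
    · exact ⟨w, fun h' => absurd h' h⟩
  choose α hαA using hαex
  have hα : ∀ v ∈ W, α v ∉ W := fun v hv h => hdis _ (hαA v hv).1 (hW h)
  have hZ : ∀ z ∈ B \ W, ∀ v, K.Adj z v → v ∈ B := by
    intro z hz v hzv
    rw [mem_sdiff] at hz
    refine (hK v z hzv.symm).resolve_left fun hv => hz.2 (mem_filter.mpr ⟨hz.1, v, hv, hzv⟩)
  have hH : ∀ u v, (within K B).Adj u v → u ∈ B ∧ v ∈ B := fun u v h => h.2
  have hconn' : ∀ C ⊆ B \ W, (∀ u ∈ C, ∀ v, (within K B).Adj u v → v ∈ C) → C = ∅ := by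
    intro C hC hcl
    have hCB : C ⊆ B := hC.trans sdiff_subset
    exact hconn C hCB fun u hu v huv => hcl u hu v ⟨huv, hCB hu, hZ u (hC hu) v huv⟩
  set R := pendantGraph W α hα with hR
  have hbip : ∀ u v, (crossing K R A B).Adj u v → (u ∈ B ↔ ¬v ∈ B) := by
    rintro u v ⟨-, ⟨h1, h2⟩ | ⟨h1, h2⟩, -⟩
    · exact iff_of_false (hdis u h1) (not_not_intro h2)
    · exact iff_of_true h1 (hdis v h2)
  have hcrossW : ∀ u v, v ∈ B → (crossing K R A B).Adj u v → v ∈ W := by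
    rintro u v hv ⟨h, ⟨h1, h2⟩ | ⟨h1, h2⟩, -⟩
    · exact mem_filter.mpr ⟨hv, u, h1, h.symm⟩
    · exact absurd hv (hdis v h2)
  have hRz : ∀ z ∈ B \ W, ∀ u, ¬R.Adj u z := by
    rintro z hz u (⟨h, -⟩ | ⟨h, rfl⟩)
    · exact (mem_sdiff.mp hz).2 h
    · exact hdis _ (hαA u h).1 (mem_sdiff.mp hz).1
  have hwA : ∀ b ∈ B, ∀ u, ¬(within K A).Adj u b := fun b hb u h => hdis b h.2.2 hb
  have hwB : ∀ a ∈ A, ∀ u, ¬(within K B).Adj u a := fun a ha u h => hdis a ha h.2.2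
  have hAnB : ∀ a ∈ A, a ∉ W := fun a ha h => hdis a ha (hW h)
  have hdisj : ∀ u v, (within K A).Adj u v → ¬(within K B).Adj u v :=
    fun u v h h' => hdis u h.2.1 h'.2.1
  obtain ⟨m, hm⟩ := exists_isSignedLabeling_neg_le_vsum (within K A)
  by_cases hp : #W = 1
  · -- the total label between `w` and `A` is known before the edges inside `B` are labelled
    obtain ⟨w, hw⟩ := card_eq_one.mp hp
    have hwB' : w ∈ B := hW (by rw [hw]; exact mem_singleton_self w)
    have hwW : w ∈ W := by rw [hw]; exact mem_singleton_self w
    rw [hw] at hconn'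
    obtain ⟨h, hh⟩ := exists_rootSeparated (within K B) B w hwB' hB hH hconn'
    obtain ⟨fU, mU, hU, hU1, hU2, hU3⟩ :=
      exists_isSignedLabeling_bipartite (crossing K R A B) (· ∈ B) hbip (h + m)
    obtain ⟨fR, hfR, hR1, -, hR2⟩ :=
      exists_isSignedLabeling_pendantGraph W α hα (fun _ => 0) (h + m + mU)
    have hUw := hU1 w hwB'
    have hRw := hR1 w hwW
    rw [hp] at hRw
    push_cast at hRw
    obtain ⟨r, hr⟩ : ∃ r : ℕ, (r : ℤ) = vsum fR w - vsum fU w :=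
      ⟨(vsum fR w - vsum fU w).toNat, Int.toNat_of_nonneg (by omega)⟩
    obtain ⟨fB, L, δ, hfB, hcase, hinj, hle⟩ := hh r (by omega)
    obtain ⟨fI, c, hfI, hIA, hIB, hc⟩ : ∃ (fI : V → V → ℤ) (c : ℕ),
        IsSignedLabeling (within K A ⊔ within K B) fI 0 (h + m) ∧
        (∀ a ∈ A, -(c : ℤ) ≤ vsum fI a) ∧ (∀ b ∈ B, vsum fI b = vsum fB b) ∧
        δ + c ≤ h + m + mU + 1 := by
      rcases hcase with ⟨rfl, rfl⟩ | ⟨hr2, hL, hδ⟩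
      · obtain ⟨fA, hfA, hA⟩ := hm h
        refine ⟨fun u v => fB u v + fA u v, h + m, ?_, fun a ha => ?_, fun b hb => ?_, by omega⟩
        · rw [sup_comm]
          exact hfB.sup (by rwa [zero_add]) fun u v h h' => hdisj u v h' h
        · rw [vsum_add, hfB.vsum_eq_zero (hwB a ha), zero_add]
          exact_mod_cast hA a
        · rw [vsum_add, hfA.vsum_eq_zero (hwA b hb), add_zero]
      · -- here `w` has only one edge to `A`, with label `h + m + 1`
        have hmU : mU = 0 := by
          by_contra hmU
          apply hmU
          refine hU.eq_zero_of_forall_not_adj fun u v huv => ?_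
          have key : ∀ u v, v ∈ B → ¬(crossing K R A B).Adj u v := by
            intro u v hv huv
            have hvw := hcrossW u v hv huv
            rw [hw, mem_singleton] at hvw
            subst hvw
            have := hU3 u v hv huv
            push_cast at this
            omega
          by_cases hv : v ∈ B
          · exact key u v hv huv
          · exact key v u ((hbip u v huv).mpr hv) huv.symm
        subst hmU
        have hnU : ∀ u v, ¬(crossing K R A B).Adj u v := fun u v huv => by
          have := hU.mem u v huv
          push_cast at this
          omega
        have hU0 := hU.vsum_eq_zero (v := w) fun u => hnU u w
        have hLm : L = m := by omega
        subst hLm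
        obtain ⟨fA, hfA, hA⟩ := hm 0
        refine ⟨fun u v => fA u v + fB u v, L, ?_, fun a ha => ?_, fun b hb => ?_, by omega⟩
        · rw [add_comm h L]
          exact hfA.sup (by rwa [zero_add]) hdisj
        · rw [vsum_add, hfB.vsum_eq_zero (hwB a ha), add_zero]
          simpa using hA a
        · rw [vsum_add, hfA.vsum_eq_zero (hwA b hb), zero_add]
    have hall := hfI.assemble hAB hK hW hα hαA hU hfR.neg
    rw [hp] at hall
    have htot : ∀ b ∈ B, vsum (fun u v => fI u v + fU u v + -fR u v) b =
        vsum fB b - if b = w then (r : ℤ) else 0 := by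
      intro b hb
      rw [vsum_add, vsum_add, vsum_neg, hIB b hb]
      split_ifs with hbw
      · subst hbw
        omega
      · have hbZ : b ∈ B \ W := mem_sdiff.mpr ⟨hb, by rw [hw, mem_singleton]; exact hbw⟩
        rw [hfR.vsum_eq_zero (hRz b hbZ), hU.vsum_eq_zero fun u huv =>
          (mem_sdiff.mp hbZ).2 (hcrossW u b hb huv)]
        ring
    refine ⟨_, _, δ, hall, fun a ha => ?_, fun b hb => ?_, fun u hu v hv huv => ?_⟩
    · rw [vsum_add, vsum_add, vsum_neg]
      have h1 := hIA a ha
      have h2 := hU2 a (hdis a ha)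
      have h3 : vsum fR a ≤ 0 := (hR2 a (hAnB a ha)).trans
        (neg_nonpos.mpr (mul_nonneg (Int.natCast_nonneg _) (Int.natCast_nonneg (_ + 1))))
      push_cast
      omega
    · rw [htot b hb]
      exact hle b hb
    · rw [htot u hu, htot v hv] at huv
      exact hinj hu hv huv
  · have hW1 : B \ W = ∅ ∨ 2 ≤ #W := by
      by_cases h0 : #W = 0
      · left
        rw [card_eq_zero] at h0
        rw [h0, sdiff_empty] at hZ ⊢
        exact hconn B subset_rfl hZ
      · right
        omega
    obtain ⟨fB, h, hfB, hinj, hle, hW2, hW3⟩ :=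
      exists_separated (within K B) B W hW hB hW1 hH hconn'
    obtain ⟨fA, hfA, hA⟩ := hm h
    obtain ⟨fU, mU, hU, hU1, hU2, -⟩ :=
      exists_isSignedLabeling_bipartite (crossing K R A B) (· ∈ B) hbip (h + m)
    obtain ⟨fR, hfR, hR1, hR3, hR2⟩ := exists_isSignedLabeling_pendantGraph W α hα
      (fun v => -(vsum fB v + vsum fU v)) (h + m + mU)
    have hfI : IsSignedLabeling (within K A ⊔ within K B) (fun u v => fB u v + fA u v) 0
        (h + m) := by
      rw [sup_comm]
      exact hfB.sup (by rwa [zero_add]) fun u v h h' => hdisj u v h' h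
    have hall := hfI.assemble hAB hK hW hα hαA hU hfR.neg
    have htotW : ∀ w ∈ W, vsum (fun u v => fB u v + fA u v + fU u v + -fR u v) w =
        vsum fB w + vsum fU w - vsum fR w := by
      intro w hw
      rw [vsum_add, vsum_add, vsum_add, vsum_neg, hfA.vsum_eq_zero (hwA w (hW hw))]
      ring
    have htotZ : ∀ z ∈ B \ W, vsum (fun u v => fB u v + fA u v + fU u v + -fR u v) z =
        vsum fB z := by
      intro z hz
      have hzB := (mem_sdiff.mp hz).1
      rw [vsum_add, vsum_add, vsum_add, vsum_neg, hfA.vsum_eq_zero (hwA z hzB),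
        hfR.vsum_eq_zero (hRz z hz), hU.vsum_eq_zero fun u huv =>
          (mem_sdiff.mp hz).2 (hcrossW u z hzB huv)]
      ring
    have hlt : ∀ w ∈ W, ∀ z ∈ B \ W, vsum fB w + vsum fU w - vsum fR w < vsum fB z := by
      intro w hw z hz
      have h1 := hW3 w hw z hz
      have h2 := hU1 w (hW hw)
      have h3 := (hR1 w hw).1
      push_cast at h3
      omega
    refine ⟨_, _, mU + #W, hall, fun a ha => ?_, fun b hb => ?_, fun u hu v hv huv => ?_⟩
    · rw [vsum_add, vsum_add, vsum_add, vsum_neg, hfB.vsum_eq_zero (hwB a ha)]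
      have h1 := hA a
      have h2 := hU2 a (hdis a ha)
      have h3 : vsum fR a ≤ 0 := (hR2 a (hAnB a ha)).trans
        (neg_nonpos.mpr (mul_nonneg (Int.natCast_nonneg _) (Int.natCast_nonneg (_ + 1))))
      push_cast
      omega
    · by_cases hbW : b ∈ W
      · rw [htotW b hbW]
        have h1 := hW2 b hbW
        have h2 := hU1 b hb
        have h3 := (hR1 b hbW).1
        push_cast at h3 ⊢
        omega
      · have hbZ := mem_sdiff.mpr ⟨hb, hbW⟩
        rw [htotZ b hbZ]
        have := hle b hbZ
        push_cast
        omega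
    · by_cases huW : u ∈ W <;> by_cases hvW : v ∈ W
      · rw [htotW u huW, htotW v hvW] at huv
        refine hR3 huW hvW ?_
        simp only
        omega
      · have hvZ := mem_sdiff.mpr ⟨hv, hvW⟩
        rw [htotW u huW, htotZ v hvZ] at huv
        exact absurd huv (hlt u huW v hvZ).ne
      · have huZ := mem_sdiff.mpr ⟨hu, huW⟩
        rw [htotW v hvW, htotZ u huZ] at huv
        exact absurd huv (hlt v hvW u huZ).ne'
      · have huZ := mem_sdiff.mpr ⟨hu, huW⟩
        have hvZ := mem_sdiff.mpr ⟨hv, hvW⟩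
        rw [htotZ u huZ, htotZ v hvZ] at huv
        exact hinj huZ hvZ huv

/-- A connected graph with a vertex `x` of maximum degree that has at most four non-neighbours has
an antimagic orientation. -/
theorem hasAntimagicOrientation_of_card_le (G : SimpleGraph V) [DecidableRel G.Adj]
    (hG : G.Connected) (hcard : Fintype.card V ≤ G.maxDegree + 5) : G.HasAntimagicOrientation := by
  classical
  have := hG.nonempty
  obtain ⟨x, hx⟩ := G.exists_maximal_degree_vertex
  set A := G.neighborFinset x with hA
  have hmemA : ∀ v, v ∈ A ↔ G.Adj x v := fun v => G.mem_neighborFinset x v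
  have hAcard : #A = G.maxDegree := by rw [hA, G.card_neighborFinset_eq_degree, hx]
  have hxA : x ∉ A := fun h => ((hmemA x).mp h).ne rfl
  set B := (insert x A)ᶜ with hBdef
  have hmemB : ∀ v, v ∈ B ↔ v ≠ x ∧ v ∉ A := fun v => by
    rw [hBdef, mem_compl, mem_insert, not_or]
  have hcover : ∀ v, v ≠ x → v ∈ A ∨ v ∈ B := fun v hv => by
    by_cases h : v ∈ A
    · exact Or.inl h
    · exact Or.inr ((hmemB v).mpr ⟨hv, h⟩)
  have hABd : Disjoint A B := Finset.disjoint_left.mpr fun v h h' => ((hmemB v).mp h').2 h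
  have hB4 : #B ≤ 4 := by
    rw [hBdef, card_compl, card_insert_of_notMem hxA, hAcard]
    omega
  set K := within G (A ∪ B) with hKdef
  have hKx : ∀ u, ¬K.Adj u x := by
    rintro u ⟨-, -, h⟩
    rcases mem_union.mp h with h | h
    · exact hxA h
    · exact ((hmemB x).mp h).1 rfl
  have hconn : ∀ C ⊆ B, (∀ u ∈ C, ∀ v, K.Adj u v → v ∈ C) → C = ∅ := by
    intro C hC hcl
    by_contra hne
    obtain ⟨c, hc⟩ := Finset.nonempty_iff_ne_empty.mpr hne
    have hreach : ∀ v, Relation.ReflTransGen G.Adj c v → v ∈ C := by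
      intro v hv
      induction hv with
      | refl => exact hc
      | @tail u v _ huv ih =>
        have huB := (hmemB u).mp (hC ih)
        have hvx : v ≠ x := by
          rintro rfl
          exact huB.2 ((hmemA u).mpr huv.symm)
        exact hcl u ih v ⟨huv, mem_union_right _ (hC ih), mem_union.mpr (hcover v hvx)⟩
    have := hreach x ((SimpleGraph.reachable_iff_reflTransGen c x).mp (hG.preconnected c x))
    exact ((hmemB x).mp (hC this)).1 rfl
  obtain ⟨f, M, δ, hf, hfA, hfB, hfinj⟩ := exists_labeling_off_star K A B hABd
    (fun u v h => mem_union.mp h.2.1) hB4 hconn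
  have hπ : ∀ v ∈ A, (fun _ : V => x) v ∉ A := fun _ _ => hxA
  obtain ⟨g, hg, hgA, hginj, hgx⟩ := exists_isSignedLabeling_pendantGraph A (fun _ => x) hπ
    (vsum f) M
  have hKG : K ⊔ pendantGraph A (fun _ => x) hπ = G := by
    ext u v
    constructor
    · rintro (h | ⟨h, rfl⟩ | ⟨h, rfl⟩)
      · exact h.1
      · exact (hmemA v).mp h
      · exact ((hmemA u).mp h).symm
    · intro h
      by_cases hu : u = x
      · subst hu
        exact Or.inr (Or.inl ⟨(hmemA v).mpr h, rfl⟩)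
      · by_cases hv : v = x
        · subst hv
          exact Or.inr (Or.inr ⟨(hmemA u).mpr h.symm, rfl⟩)
        · exact Or.inl ⟨h, mem_union.mpr (hcover u hu), mem_union.mpr (hcover v hv)⟩
  have hfg : IsSignedLabeling G (fun u v => f u v + g u v) 0 (M + #A) := by
    rw [← hKG]
    refine hf.sup (by rwa [zero_add]) ?_
    rintro u v h (⟨-, rfl⟩ | ⟨-, rfl⟩)
    · exact hKx v h.symm
    · exact hKx u h
  have htA : ∀ a ∈ A, (δ : ℤ) < vsum (fun u v => f u v + g u v) a := fun a ha => by
    have h1 := hfA a ha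
    have h2 := (hgA a ha).1
    rw [vsum_add]
    omega
  have htB : ∀ b ∈ B, vsum (fun u v => f u v + g u v) b = vsum f b := fun b hb => by
    rw [vsum_add, hg.vsum_eq_zero, add_zero]
    rintro u (⟨h, -⟩ | ⟨-, rfl⟩)
    · exact ((hmemB b).mp hb).2 h
    · exact ((hmemB b).mp hb).1 rfl
  have htx : vsum (fun u v => f u v + g u v) x ≤ -(#A * (M + 1 : ℤ)) := by
    have := hgx x hxA
    rw [filter_true_of_mem fun _ _ => rfl] at this
    rw [vsum_add, hf.vsum_eq_zero hKx, zero_add]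
    exact this
  have hBlow : ∀ b ∈ B, -(#A * (M : ℤ)) ≤ vsum f b := fun b _ => by
    have h1 := hf.neg_le_vsum b
    have h2 : K.degree b ≤ #A := by
      rw [hAcard]
      exact (SimpleGraph.degree_le_of_le fun u v (h : K.Adj u v) => h.1).trans
        (G.degree_le_maxDegree b)
    have h3 : (K.degree b : ℤ) * M ≤ #A * M := by
      have : (K.degree b : ℤ) ≤ #A := by exact_mod_cast h2
      gcongr
    push_cast at h1
    rw [zero_add] at h1
    linarith
  have hxA' : ∀ a ∈ A, vsum (fun u v => f u v + g u v) x < vsum (fun u v => f u v + g u v) a :=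
    fun a ha => by
      have h1 := htA a ha
      have h2 : (0 : ℤ) ≤ #A * (M + 1 : ℤ) := by positivity
      linarith
  have hxB : ∀ b ∈ B, vsum (fun u v => f u v + g u v) x < vsum f b := fun b hb => by
    have hA0 : (0 : ℤ) < #A := by
      -- otherwise `B` is closed under adjacency
      by_contra h0
      have hAe : A = ∅ := by
        rw [← card_eq_zero]
        omega
      have := hconn B subset_rfl fun u _ v huv => by
        have := huv.2.2
        rwa [hAe, empty_union] at this
      rw [this] at hb
      exact absurd hb (Finset.notMem_empty b)
    have h1 := hBlow b hb
    rw [mul_add, mul_one] at htx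
    linarith
  have hAB' : ∀ a ∈ A, ∀ b ∈ B, vsum f b < vsum (fun u v => f u v + g u v) a :=
    fun a ha b hb => (hfB b hb).trans_lt (htA a ha)
  refine hfg.hasAntimagicOrientation fun u v huv => ?_
  by_cases hu : u = x
  · by_cases hv : v = x
    · rw [hu, hv]
    · rw [hu] at huv
      rcases hcover v hv with hv | hv
      · exact absurd huv (hxA' v hv).ne
      · rw [htB v hv] at huv
        exact absurd huv (hxB v hv).ne
  · by_cases hv : v = x
    · rw [hv] at huv
      rcases hcover u hu with hu | hu
      · exact absurd huv (hxA' u hu).ne'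
      · rw [htB u hu] at huv
        exact absurd huv (hxB u hu).ne'
    · rcases hcover u hu with hu | hu <;> rcases hcover v hv with hv | hv
      · rw [vsum_add, vsum_add] at huv
        exact hginj hu hv huv
      · rw [htB v hv] at huv
        exact absurd huv (hAB' u hu v hv).ne'
      · rw [htB u hu] at huv
        exact absurd huv (hAB' v hv u hu).ne
      · rw [htB u hu, htB v hv] at huv
        exact hfinj hu hv huv

end Layers

theorem theorem1p2 {V : Type*} [Fintype V] (G : SimpleGraph V) [DecidableRel G.Adj]
    (hG : G.Connected) :
    ((G.maxDegree : ℤ) ≥ (Fintype.card V : ℤ) - 3 → G.HasAntimagicOrientation) ∧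
    (∀ t : ℤ, t = 4 ∨ t = 5 →
      (G.maxDegree : ℤ) = (Fintype.card V : ℤ) - t → (Fintype.card V : ℤ) - t ≥ 4 →
      G.HasAntimagicOrientation) := by
  classical
  refine ⟨fun h => ?_, fun t ht h _ => ?_⟩ <;>
    exact hasAntimagicOrientation_of_card_le G hG (by omega)
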